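/- Let $X$ be a set and let $X'=\{x' : x\in X\}$ be a disjoint copy of $X$. The partial Brauer monoid $\mathcal{PB}_X$ consists of all graphs on the vertex set $X\cup X'$ in which every vertex has degree at most $1$. The product $\alpha\beta$ of $\alpha,\beta\in\mathcal{PB}_X$ is obtained as follows: take a third disjoint copy $X''=\{x'' : x\in X\}$ of $X$, rename each vertex $x'$ of $\alpha$ to $x''$ and each vertex $x$ of $\beta$ to $x''$, and let $\Pi(\alpha,\beta)$ be the graph on $X\cup X''\cup X'$ with all the edges of both; then $\alpha\beta$ is the graph on $X\cup X'$ in which two distinct vertices are adjacent if and only if they lie in the same connected component of $\Pi(\alpha,\beta)$. The identity is the graph with edges $\{x,x'\}$, $x\in X$. For $\alpha\in\mathcal{PB}_X$ put $$\operatorname{dom}(\alpha)=\{x\in X : \{x,y'\}\text{ is an edge of }\alpha\text{ for some }y\in X\},\qquad \operatorname{codom}(\alpha)=\{y\in X : \{x,y'\}\text{ is an edge of }\alpha\text{ for some }x\in X\},$$ $$\operatorname{Fix}(\alpha)=\{x\in X : \{x,x'\}\text{ is an edge of }\alpha\},$$ and define the cardinals $$\operatorname{def}(\alpha)=|X\setminus\operatorname{dom}(\alpha)|,\quad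 \operatorname{codef}(\alpha)=|X\setminus\operatorname{codom}(\alpha)|,\quad \operatorname{supp}(\alpha)=|X\setminus\operatorname{Fix}(\alpha)|,\quad \operatorname{sh}(\alpha)=|\operatorname{dom}(\alpha)\setminus\operatorname{Fix}(\alpha)|.$$ Theorem. If $X$ is infinite, then the subsemigroup $\mathbb{E}(\mathcal{PB}_X)$ of $\mathcal{PB}_X$ generated by all idempotents of $\mathcal{PB}_X$ (which contains the identity, and so is also the submonoid they generate) is $$\mathbb{E}(\mathcal{PB}_X)=\{\alpha : \operatorname{def}(\alpha)\le 1,\ \operatorname{sh}(\alpha)=0\}\ \cup\ \{\alpha : \operatorname{def}(\alpha)\ge 2,\ \operatorname{supp}(\alpha)<\aleph_0\}\ \cup\ \{\alpha : \operatorname{def}(\alpha)=\operatorname{codef}(\alpha)\ge\max(\aleph_0,\operatorname{sh}(\alpha))\},$$ where $\alpha$ ranges over $\mathcal{PB}_X$ in each of the three sets. -/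

import Mathlib

universe u

/-- A Brauer graph on an upper row `X` (the summand `Sum.inl`) and a lower row `X'` (the summand
`Sum.inr`): a graph on the disjoint union of the two rows in which every vertex has degree at
most one. -/
@[ext]
structure BrauerGraph (X : Type u) where
  /-- The underlying graph on the two rows. -/
  graph : SimpleGraph (X ⊕ X)
  /-- Every vertex has at most one neighbour. -/
  eq_of_adj : ∀ {v w w' : X ⊕ X}, graph.Adj v w → graph.Adj v w' → w = w'

namespace BrauerGraph

/-- The vertices of a product graph: three disjoint copies of `X`. -/
inductive ProdVertex (X : Type u) : Type u
  | upper (x : X) : ProdVertex X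
  | middle (x : X) : ProdVertex X
  | lower (x : X) : ProdVertex X

variable {X : Type u}

/-- The first factor of a product sits on the upper and the middle row. -/
def topTwo : X ⊕ X → ProdVertex X := Sum.elim ProdVertex.upper ProdVertex.middle

/-- The second factor of a product sits on the middle and the lower row. -/
def bottomTwo : X ⊕ X → ProdVertex X := Sum.elim ProdVertex.middle ProdVertex.lower

/-- The product of the two factors sits on the upper and the lower row. -/
def outerTwo : X ⊕ X → ProdVertex X := Sum.elim ProdVertex.upper ProdVertex.lower

/-- The product graph of `α` and `β`: the edges of `α`, drawn between the upper and the middle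
row, together with the edges of `β`, drawn between the middle and the lower row. (Parallel edges
are merged, which does not affect the connected components.) -/
def prodGraph (α β : BrauerGraph X) : SimpleGraph (ProdVertex X) :=
  α.graph.map topTwo ⊔ β.graph.map bottomTwo

theorem topTwo_injective : Function.Injective (topTwo (X := X)) := by
  rintro (v | v) (w | w) h <;> simp_all [topTwo]

theorem bottomTwo_injective : Function.Injective (bottomTwo (X := X)) := by
  rintro (v | v) (w | w) h <;> simp_all [bottomTwo]

theorem outerTwo_injective : Function.Injective (outerTwo (X := X)) := by
  rintro (v | v) (w | w) h <;> simp_all [outerTwo]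

theorem prodGraph_adj (α β : BrauerGraph X) (a b : ProdVertex X) : (prodGraph α β).Adj a b ↔
    (∃ v w, topTwo v = a ∧ topTwo w = b ∧ α.graph.Adj v w) ∨
      (∃ v w, bottomTwo v = a ∧ bottomTwo w = b ∧ β.graph.Adj v w) := by
  simp only [prodGraph, SimpleGraph.sup_adj, SimpleGraph.map_adj']
  constructor
  · rintro (⟨-, v, w, h, rfl, rfl⟩ | ⟨-, v, w, h, rfl, rfl⟩)
    · exact Or.inl ⟨v, w, rfl, rfl, h⟩
    · exact Or.inr ⟨v, w, rfl, rfl, h⟩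
  · rintro (⟨v, w, rfl, rfl, h⟩ | ⟨v, w, rfl, rfl, h⟩)
    · exact Or.inl ⟨fun e => h.ne (topTwo_injective e), v, w, h, rfl, rfl⟩
    · exact Or.inr ⟨fun e => h.ne (bottomTwo_injective e), v, w, h, rfl, rfl⟩

/-- In a graph of maximum degree two, two paths that leave a common vertex in the same direction
and end in leaves end in the same leaf. -/
theorem path_end_unique {V : Type u} {G : SimpleGraph V}
    (hG : ∀ a b c d, G.Adj a b → G.Adj a c → G.Adj a d → b = c ∨ b = d ∨ c = d)
    {v w : V} (hv : ∀ c d, G.Adj v c → G.Adj v d → c = d)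
    (hw : ∀ c d, G.Adj w c → G.Adj w d → c = d) :
    ∀ {a b : V} (p : G.Walk a v) (q : G.Walk a w), G.Adj a b → p.IsPath → q.IsPath →
      b ∉ p.support → b ∉ q.support → v = w := by
  intro a b p
  induction p generalizing b with
  | nil =>
    intro q hab _ hq _ hbq
    cases q with
    | nil => rfl
    | cons h q' =>
      exact absurd (by simp [hv _ _ hab h]) hbq
  | cons h p' ih =>
    intro q hab hp hq hbp hbq
    cases q with
    | nil => exact absurd (by simp [hw _ _ hab h]) hbp
    | cons h' q' =>
      rw [SimpleGraph.Walk.cons_isPath_iff] at hp hq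
      rcases hG _ _ _ _ hab h h' with e | e | e
      · exact absurd (by simp [e]) hbp
      · exact absurd (by simp [e]) hbq
      · subst e
        exact ih hv q' h.symm hp.1 hq.1 hp.2 hq.2

theorem leaf_unique {V : Type u} {G : SimpleGraph V}
    (hG : ∀ a b c d, G.Adj a b → G.Adj a c → G.Adj a d → b = c ∨ b = d ∨ c = d)
    {u v w : V} (hu : ∀ c d, G.Adj u c → G.Adj u d → c = d)
    (hv : ∀ c d, G.Adj v c → G.Adj v d → c = d)
    (hw : ∀ c d, G.Adj w c → G.Adj w d → c = d)
    (huv : u ≠ v) (huw : u ≠ w) (h₁ : G.Reachable u v) (h₂ : G.Reachable u w) : v = w := by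
  classical
  obtain ⟨p⟩ := h₁
  obtain ⟨q⟩ := h₂
  have hp := p.bypass_isPath
  have hq := q.bypass_isPath
  generalize p.bypass = p at hp
  generalize q.bypass = q at hq
  cases p with
  | nil => exact absurd rfl huv
  | cons h p' =>
    cases q with
    | nil => exact absurd rfl huw
    | cons h' q' =>
      rw [SimpleGraph.Walk.cons_isPath_iff] at hp hq
      obtain rfl := hu _ _ h h'
      exact path_end_unique hG hv hw p' q' h.symm hp.1 hq.1 hp.2 hq.2

theorem prodGraph_degree (α β : BrauerGraph X) (a b c d : ProdVertex X)
    (hb : (prodGraph α β).Adj a b) (hc : (prodGraph α β).Adj a c) (hd : (prodGraph α β).Adj a d) :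
    b = c ∨ b = d ∨ c = d := by
  rw [prodGraph_adj] at hb hc hd
  have top : ∀ {v w v' w' : X ⊕ X} {b c}, topTwo v = a → topTwo w = b → α.graph.Adj v w →
      topTwo v' = a → topTwo w' = c → α.graph.Adj v' w' → b = c := by
    intro v w v' w' b c h1 h2 h3 h4 h5 h6
    obtain rfl := topTwo_injective (h1.trans h4.symm)
    rw [← h2, ← h5, α.eq_of_adj h3 h6]
  have bot : ∀ {v w v' w' : X ⊕ X} {b c}, bottomTwo v = a → bottomTwo w = b → β.graph.Adj v w →
      bottomTwo v' = a → bottomTwo w' = c → β.graph.Adj v' w' → b = c := by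
    intro v w v' w' b c h1 h2 h3 h4 h5 h6
    obtain rfl := bottomTwo_injective (h1.trans h4.symm)
    rw [← h2, ← h5, β.eq_of_adj h3 h6]
  rcases hb with ⟨v, w, h1, h2, h3⟩ | ⟨v, w, h1, h2, h3⟩ <;>
  rcases hc with ⟨v', w', h4, h5, h6⟩ | ⟨v', w', h4, h5, h6⟩ <;>
  rcases hd with ⟨v'', w'', h7, h8, h9⟩ | ⟨v'', w'', h7, h8, h9⟩
  · exact Or.inl (top h1 h2 h3 h4 h5 h6)
  · exact Or.inl (top h1 h2 h3 h4 h5 h6)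
  · exact Or.inr (Or.inl (top h1 h2 h3 h7 h8 h9))
  · exact Or.inr (Or.inr (bot h4 h5 h6 h7 h8 h9))
  · exact Or.inr (Or.inr (top h4 h5 h6 h7 h8 h9))
  · exact Or.inr (Or.inl (bot h1 h2 h3 h7 h8 h9))
  · exact Or.inl (bot h1 h2 h3 h4 h5 h6)
  · exact Or.inl (bot h1 h2 h3 h4 h5 h6)

theorem prodGraph_outer_degree (α β : BrauerGraph X) (v : X ⊕ X) (c d : ProdVertex X)
    (hc : (prodGraph α β).Adj (outerTwo v) c) (hd : (prodGraph α β).Adj (outerTwo v) d) :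
    c = d := by
  rw [prodGraph_adj] at hc hd
  rcases v with x | x
  · rcases hc with ⟨v, w, h1, h2, h3⟩ | ⟨v | v, w, h1, h2, h3⟩
    · rcases hd with ⟨v', w', h4, h5, h6⟩ | ⟨v' | v', w', h4, h5, h6⟩
      · obtain rfl := topTwo_injective (h1.trans h4.symm)
        rw [← h2, ← h5, α.eq_of_adj h3 h6]
      all_goals simp [bottomTwo, outerTwo] at h4
    all_goals simp [bottomTwo, outerTwo] at h1
  · rcases hc with ⟨v | v, w, h1, h2, h3⟩ | ⟨v, w, h1, h2, h3⟩
    · simp [topTwo, outerTwo] at h1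
    · simp [topTwo, outerTwo] at h1
    · rcases hd with ⟨v' | v', w', h4, h5, h6⟩ | ⟨v', w', h4, h5, h6⟩
      · simp [topTwo, outerTwo] at h4
      · simp [topTwo, outerTwo] at h4
      · obtain rfl := bottomTwo_injective (h1.trans h4.symm)
        rw [← h2, ← h5, β.eq_of_adj h3 h6]

/-- The product of Brauer graphs: distinct vertices of the upper and lower rows are joined when
they lie in the same connected component of the product graph. -/
instance : Mul (BrauerGraph X) where
  mul α β :=
    { graph :=
        { Adj := fun v w => v ≠ w ∧ (prodGraph α β).Reachable (outerTwo v) (outerTwo w)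
          symm := ⟨fun _ _ h => ⟨h.1.symm, h.2.symm⟩⟩
          loopless := ⟨fun _ h => h.1 rfl⟩ }
      eq_of_adj := fun {v w w'} h h' => outerTwo_injective <|
        leaf_unique (prodGraph_degree α β) (prodGraph_outer_degree α β v)
          (prodGraph_outer_degree α β w) (prodGraph_outer_degree α β w')
          (fun e => h.1 (outerTwo_injective e)) (fun e => h'.1 (outerTwo_injective e)) h.2 h'.2 }

/-- The identity Brauer graph, with edges `{x, x'}` for all `x`. -/
instance : One (BrauerGraph X) where
  one :=
    { graph :=
        { Adj := fun v w => v = w.swap ∧ v ≠ w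
          symm := ⟨by rintro v w ⟨rfl, h⟩; simpa using h.symm⟩
          loopless := ⟨fun _ h => h.2 rfl⟩ }
      eq_of_adj := by
        rintro v w w' ⟨rfl, -⟩ ⟨h, -⟩
        exact Sum.swap_leftInverse.injective h }

theorem mul_adj (α β : BrauerGraph X) (v w : X ⊕ X) : (α * β).graph.Adj v w ↔
    v ≠ w ∧ (prodGraph α β).Reachable (outerTwo v) (outerTwo w) := Iff.rfl

theorem one_adj (v w : X ⊕ X) : (1 : BrauerGraph X).graph.Adj v w ↔ v = w.swap ∧ v ≠ w := Iff.rfl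

/-- Replacing a part of a graph by the connections it induces between its boundary vertices does
not change connectivity. -/
theorem reachable_contract {V U W B : Type u} {T : SimpleGraph V} {H : SimpleGraph W}
    {K : SimpleGraph U} (k : W → V) (j : U → V) (o : B → W) (l : B → U)
    (hk : Function.Injective k) (hj : Function.Injective j)
    (h₀ : ∀ u w, j u = k w → ∃ b, u = l b ∧ w = o b)
    (h₁ : ∀ a b, T.Adj a b → (∃ a' b', k a' = a ∧ k b' = b ∧ H.Adj a' b') ∨
      (∃ a' b', j a' = a ∧ j b' = b ∧ K.Adj a' b'))
    (h₃ : ∀ a b, K.Adj a b → T.Reachable (j a) (j b))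
    (h₄ : ∀ a b, H.Reachable (o a) (o b) → K.Reachable (l a) (l b)) (u v : U) :
    T.Reachable (j u) (j v) ↔ K.Reachable u v := by
  constructor
  · have key : ∀ a, T.Reachable (j u) a → (∀ a', j a' = a → K.Reachable u a') ∧
        (∀ a', k a' = a → ∃ c, K.Reachable u (l c) ∧ H.Reachable (o c) a') := by
      intro a h
      rw [SimpleGraph.reachable_iff_reflTransGen] at h
      induction h with
      | refl =>
        refine ⟨fun a' h => hj h ▸ SimpleGraph.Reachable.refl _, fun a' h => ?_⟩
        obtain ⟨b, rfl, rfl⟩ := h₀ _ _ h.symm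
        exact ⟨b, .refl _, .refl _⟩
      | tail _ hab ih =>
        have step : ∀ b', (∃ c, K.Reachable u (l c) ∧ H.Reachable (o c) b') → ∀ a', j a' = k b' →
              K.Reachable u a' := by
          rintro b' ⟨c, h1, h2⟩ a' h3
          obtain ⟨b, rfl, rfl⟩ := h₀ _ _ h3
          exact h1.trans (h₄ _ _ h2)
        rcases h₁ _ _ hab with ⟨a', b', rfl, rfl, h⟩ | ⟨a', b', rfl, rfl, h⟩
        · obtain ⟨c, h1, h2⟩ := ih.2 a' rfl
          have h3 : ∃ c, K.Reachable u (l c) ∧ H.Reachable (o c) b' :=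
            ⟨c, h1, h2.trans h.reachable⟩
          refine ⟨fun x hx => step b' h3 x hx, fun x hx => ?_⟩
          rw [hk hx]
          exact h3
        · have h3 := (ih.1 a' rfl).trans h.reachable
          refine ⟨fun x hx => hj hx ▸ h3, fun x hx => ?_⟩
          obtain ⟨b, rfl, rfl⟩ := h₀ _ _ hx.symm
          exact ⟨b, h3, .refl _⟩
    exact fun h => (key _ h).1 v rfl
  · intro h
    rw [SimpleGraph.reachable_iff_reflTransGen] at h
    induction h with
    | refl => exact .refl _
    | tail _ hab ih => exact ih.trans (h₃ _ _ hab)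

/-- Placing a Brauer graph on the rows `i` and `j` of a stack of four copies of `X`. -/
def rowTwo (i j : Fin 4) : X ⊕ X → Fin 4 × X := Sum.elim (Prod.mk i) (Prod.mk j)

/-- Placing a product graph on the rows `i`, `j` and `k` of a stack of four copies of `X`. -/
def rowThree (i j k : Fin 4) : ProdVertex X → Fin 4 × X
  | .upper x => (i, x)
  | .middle x => (j, x)
  | .lower x => (k, x)

/-- The graph on four rows formed by three consecutive Brauer graphs. -/
def tripleGraph (α β γ : BrauerGraph X) : SimpleGraph (Fin 4 × X) :=
  α.graph.map (rowTwo 0 1) ⊔ β.graph.map (rowTwo 1 2) ⊔ γ.graph.map (rowTwo 2 3)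

theorem rowTwo_injective {i j : Fin 4} (h : i ≠ j) :
    Function.Injective (rowTwo i j : X ⊕ X → Fin 4 × X) := by
  rintro (v | v) (w | w) e <;> simp_all [rowTwo, eq_comm]

theorem rowThree_injective {i j k : Fin 4} (h : i ≠ j) (h' : i ≠ k) (h'' : j ≠ k) :
    Function.Injective (rowThree i j k : ProdVertex X → Fin 4 × X) := by
  rintro (v | v | v) (w | w | w) e <;> simp_all [rowThree, eq_comm]

theorem rowThree_topTwo (i j k : Fin 4) (v : X ⊕ X) :
    rowThree i j k (topTwo v) = rowTwo i j v := by
  rcases v with v | v <;> rfl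

theorem rowThree_bottomTwo (i j k : Fin 4) (v : X ⊕ X) :
    rowThree i j k (bottomTwo v) = rowTwo j k v := by
  rcases v with v | v <;> rfl

theorem rowThree_outerTwo (i j k : Fin 4) (v : X ⊕ X) :
    rowThree i j k (outerTwo v) = rowTwo i k v := by
  rcases v with v | v <;> rfl

theorem tripleGraph_adj (α β γ : BrauerGraph X) (a b : Fin 4 × X) :
    (tripleGraph α β γ).Adj a b ↔
      (∃ v w, rowTwo 0 1 v = a ∧ rowTwo 0 1 w = b ∧ α.graph.Adj v w) ∨
      (∃ v w, rowTwo 1 2 v = a ∧ rowTwo 1 2 w = b ∧ β.graph.Adj v w) ∨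
      (∃ v w, rowTwo 2 3 v = a ∧ rowTwo 2 3 w = b ∧ γ.graph.Adj v w) := by
  simp only [tripleGraph, SimpleGraph.sup_adj, SimpleGraph.map_adj', or_assoc]
  constructor
  · rintro (⟨-, v, w, h, rfl, rfl⟩ | ⟨-, v, w, h, rfl, rfl⟩ | ⟨-, v, w, h, rfl, rfl⟩)
    · exact Or.inl ⟨v, w, rfl, rfl, h⟩
    · exact Or.inr (Or.inl ⟨v, w, rfl, rfl, h⟩)
    · exact Or.inr (Or.inr ⟨v, w, rfl, rfl, h⟩)
  · rintro (⟨v, w, rfl, rfl, h⟩ | ⟨v, w, rfl, rfl, h⟩ | ⟨v, w, rfl, rfl, h⟩)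
    · exact Or.inl ⟨fun e => h.ne (rowTwo_injective (by decide) e), v, w, h, rfl, rfl⟩
    · exact Or.inr (Or.inl ⟨fun e => h.ne (rowTwo_injective (by decide) e), v, w, h, rfl, rfl⟩)
    · exact Or.inr (Or.inr ⟨fun e => h.ne (rowTwo_injective (by decide) e), v, w, h, rfl, rfl⟩)

theorem tripleGraph_left (α β γ : BrauerGraph X) (u v : ProdVertex X) :
    (tripleGraph α β γ).Reachable (rowThree 0 2 3 u) (rowThree 0 2 3 v) ↔
      (prodGraph (α * β) γ).Reachable u v := by
  have sub : ∀ a b, (prodGraph α β).Adj a b →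
      (tripleGraph α β γ).Adj (rowThree 0 1 2 a) (rowThree 0 1 2 b) := by
    intro a b h
    rw [prodGraph_adj] at h
    rw [tripleGraph_adj]
    rcases h with ⟨v, w, rfl, rfl, h⟩ | ⟨v, w, rfl, rfl, h⟩
    · exact Or.inl ⟨v, w, (rowThree_topTwo ..).symm, (rowThree_topTwo ..).symm, h⟩
    · exact Or.inr (Or.inl ⟨v, w, (rowThree_bottomTwo ..).symm, (rowThree_bottomTwo ..).symm, h⟩)
  refine reachable_contract (H := prodGraph α β) (rowThree 0 1 2) (rowThree 0 2 3) outerTwo topTwo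
    (rowThree_injective (by decide) (by decide) (by decide))
    (rowThree_injective (by decide) (by decide) (by decide))
    ?_ ?_ ?_ ?_ u v
  · rintro (u | u | u) (w | w | w) h <;> simp [rowThree] at h
    · exact ⟨Sum.inl u, rfl, by rw [h]; rfl⟩
    · exact ⟨Sum.inr u, rfl, by rw [h]; rfl⟩
  · intro a b h
    rw [tripleGraph_adj] at h
    rcases h with ⟨v, w, rfl, rfl, h⟩ | ⟨v, w, rfl, rfl, h⟩ | ⟨v, w, rfl, rfl, h⟩
    · exact Or.inl ⟨topTwo v, topTwo w, rowThree_topTwo .., rowThree_topTwo ..,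
        (prodGraph_adj ..).2 (Or.inl ⟨v, w, rfl, rfl, h⟩)⟩
    · exact Or.inl ⟨bottomTwo v, bottomTwo w, rowThree_bottomTwo .., rowThree_bottomTwo ..,
        (prodGraph_adj ..).2 (Or.inr ⟨v, w, rfl, rfl, h⟩)⟩
    · exact Or.inr ⟨bottomTwo v, bottomTwo w, rowThree_bottomTwo .., rowThree_bottomTwo ..,
        (prodGraph_adj ..).2 (Or.inr ⟨v, w, rfl, rfl, h⟩)⟩
  · intro a b h
    rw [prodGraph_adj] at h
    rcases h with ⟨v, w, rfl, rfl, h⟩ | ⟨v, w, rfl, rfl, h⟩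
    · have := h.2.map (G' := tripleGraph α β γ) ⟨rowThree 0 1 2, fun {a b} => sub a b⟩
      rw [rowThree_topTwo, rowThree_topTwo, ← rowThree_outerTwo 0 1 2, ← rowThree_outerTwo 0 1 2]
      exact this
    · rw [rowThree_bottomTwo, rowThree_bottomTwo]
      exact SimpleGraph.Adj.reachable
        ((tripleGraph_adj ..).2 (Or.inr (Or.inr ⟨v, w, rfl, rfl, h⟩)))
  · intro a b h
    by_cases e : a = b
    · rw [e]
    · exact SimpleGraph.Adj.reachable
        ((prodGraph_adj ..).2 (Or.inl ⟨a, b, rfl, rfl, (mul_adj ..).2 ⟨e, h⟩⟩))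

theorem tripleGraph_right (α β γ : BrauerGraph X) (u v : ProdVertex X) :
    (tripleGraph α β γ).Reachable (rowThree 0 1 3 u) (rowThree 0 1 3 v) ↔
      (prodGraph α (β * γ)).Reachable u v := by
  have sub : ∀ a b, (prodGraph β γ).Adj a b →
      (tripleGraph α β γ).Adj (rowThree 1 2 3 a) (rowThree 1 2 3 b) := by
    intro a b h
    rw [prodGraph_adj] at h
    rw [tripleGraph_adj]
    rcases h with ⟨v, w, rfl, rfl, h⟩ | ⟨v, w, rfl, rfl, h⟩
    · exact Or.inr (Or.inl ⟨v, w, (rowThree_topTwo ..).symm, (rowThree_topTwo ..).symm, h⟩)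
    · exact Or.inr (Or.inr ⟨v, w, (rowThree_bottomTwo ..).symm, (rowThree_bottomTwo ..).symm, h⟩)
  refine reachable_contract (H := prodGraph β γ) (rowThree 1 2 3) (rowThree 0 1 3) outerTwo
    bottomTwo (rowThree_injective (by decide) (by decide) (by decide))
    (rowThree_injective (by decide) (by decide) (by decide))
    ?_ ?_ ?_ ?_ u v
  · rintro (u | u | u) (w | w | w) h <;> simp [rowThree] at h
    · exact ⟨Sum.inl u, rfl, by rw [h]; rfl⟩
    · exact ⟨Sum.inr u, rfl, by rw [h]; rfl⟩
  · intro a b h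
    rw [tripleGraph_adj] at h
    rcases h with ⟨v, w, rfl, rfl, h⟩ | ⟨v, w, rfl, rfl, h⟩ | ⟨v, w, rfl, rfl, h⟩
    · exact Or.inr ⟨topTwo v, topTwo w, rowThree_topTwo .., rowThree_topTwo ..,
        (prodGraph_adj ..).2 (Or.inl ⟨v, w, rfl, rfl, h⟩)⟩
    · exact Or.inl ⟨topTwo v, topTwo w, rowThree_topTwo .., rowThree_topTwo ..,
        (prodGraph_adj ..).2 (Or.inl ⟨v, w, rfl, rfl, h⟩)⟩
    · exact Or.inl ⟨bottomTwo v, bottomTwo w, rowThree_bottomTwo .., rowThree_bottomTwo ..,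
        (prodGraph_adj ..).2 (Or.inr ⟨v, w, rfl, rfl, h⟩)⟩
  · intro a b h
    rw [prodGraph_adj] at h
    rcases h with ⟨v, w, rfl, rfl, h⟩ | ⟨v, w, rfl, rfl, h⟩
    · rw [rowThree_topTwo, rowThree_topTwo]
      exact SimpleGraph.Adj.reachable ((tripleGraph_adj ..).2 (Or.inl ⟨v, w, rfl, rfl, h⟩))
    · have := h.2.map (G' := tripleGraph α β γ) ⟨rowThree 1 2 3, fun {a b} => sub a b⟩
      rw [rowThree_bottomTwo, rowThree_bottomTwo, ← rowThree_outerTwo 1 2 3,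
        ← rowThree_outerTwo 1 2 3]
      exact this
  · intro a b h
    by_cases e : a = b
    · rw [e]
    · exact SimpleGraph.Adj.reachable
        ((prodGraph_adj ..).2 (Or.inr ⟨a, b, rfl, rfl, (mul_adj ..).2 ⟨e, h⟩⟩))

/-- A map that contracts every edge of a product graph to an edge of `δ` or to a point. -/
theorem adj_of_contract {α β δ : BrauerGraph X} (f : ProdVertex X → X ⊕ X)
    (hf : ∀ a b, (prodGraph α β).Adj a b → f a = f b ∨ δ.graph.Adj (f a) (f b))
    {a b : ProdVertex X} (h : (prodGraph α β).Reachable a b) :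
    f a = f b ∨ δ.graph.Adj (f a) (f b) := by
  rw [SimpleGraph.reachable_iff_reflTransGen] at h
  induction h with
  | refl => exact Or.inl rfl
  | tail _ hab ih =>
    rcases ih with ih | ih
    · rw [ih]; exact hf _ _ hab
    · rcases hf _ _ hab with h | h
      · rw [← h]; exact Or.inr ih
      · exact Or.inl (δ.eq_of_adj ih.symm h)

theorem one_mul' (β : BrauerGraph X) : 1 * β = β := by
  ext v w
  rw [mul_adj]
  constructor
  · rintro ⟨hne, h⟩
    let f : ProdVertex X → X ⊕ X := fun a => match a with
      | .upper x => Sum.inl x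
      | .middle x => Sum.inl x
      | .lower x => Sum.inr x
    have hf : ∀ v, f (outerTwo v) = v := by rintro (v | v) <;> rfl
    have := adj_of_contract (δ := β) f (fun a b h => ?_) h
    · rw [hf, hf] at this
      exact this.resolve_left hne
    · rw [prodGraph_adj] at h
      rcases h with ⟨v, w, rfl, rfl, ⟨rfl, h⟩⟩ | ⟨v, w, rfl, rfl, h⟩
      · left; rcases w with w | w <;> rfl
      · right
        have hb : ∀ v, f (bottomTwo v) = v := by rintro (v | v) <;> rfl
        rwa [hb, hb]
  · intro h
    refine ⟨h.ne, ?_⟩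
    have key : ∀ v : X ⊕ X, (prodGraph 1 β).Reachable (outerTwo v) (bottomTwo v) := by
      rintro (v | v)
      · exact SimpleGraph.Adj.reachable
          ((prodGraph_adj ..).2 (Or.inl ⟨Sum.inl v, Sum.inr v, rfl, rfl, rfl, by simp⟩))
      · exact .refl _
    exact (key v).trans ((SimpleGraph.Adj.reachable
      ((prodGraph_adj ..).2 (Or.inr ⟨v, w, rfl, rfl, h⟩))).trans (key w).symm)

theorem mul_one' (β : BrauerGraph X) : β * 1 = β := by
  ext v w
  rw [mul_adj]
  constructor
  · rintro ⟨hne, h⟩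
    let f : ProdVertex X → X ⊕ X := fun a => match a with
      | .upper x => Sum.inl x
      | .middle x => Sum.inr x
      | .lower x => Sum.inr x
    have hf : ∀ v, f (outerTwo v) = v := by rintro (v | v) <;> rfl
    have := adj_of_contract (δ := β) f (fun a b h => ?_) h
    · rw [hf, hf] at this
      exact this.resolve_left hne
    · rw [prodGraph_adj] at h
      rcases h with ⟨v, w, rfl, rfl, h⟩ | ⟨v, w, rfl, rfl, ⟨rfl, h⟩⟩
      · right
        have hb : ∀ v, f (topTwo v) = v := by rintro (v | v) <;> rfl
        rwa [hb, hb]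
      · left; rcases w with w | w <;> rfl
  · intro h
    refine ⟨h.ne, ?_⟩
    have key : ∀ v : X ⊕ X, (prodGraph β 1).Reachable (outerTwo v) (topTwo v) := by
      rintro (v | v)
      · exact .refl _
      · exact SimpleGraph.Adj.reachable
          ((prodGraph_adj ..).2 (Or.inr ⟨Sum.inr v, Sum.inl v, rfl, rfl, rfl, by simp⟩))
    exact (key v).trans ((SimpleGraph.Adj.reachable
      ((prodGraph_adj ..).2 (Or.inl ⟨v, w, rfl, rfl, h⟩))).trans (key w).symm)

/-- The partial Brauer monoid on `X`. -/
instance : Monoid (BrauerGraph X) where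
  mul_assoc α β γ := by
    ext v w
    rw [mul_adj, mul_adj, ← tripleGraph_left, ← tripleGraph_right]
    simp only [rowThree_outerTwo]
  one_mul := one_mul'
  mul_one := mul_one'

/-- The points of the upper row that belong to a transversal. -/
def dom (α : BrauerGraph X) : Set X := {x | ∃ y, α.graph.Adj (Sum.inl x) (Sum.inr y)}

/-- The points of the lower row that belong to a transversal. -/
def codom (α : BrauerGraph X) : Set X := {y | ∃ x, α.graph.Adj (Sum.inl x) (Sum.inr y)}

/-- The points `x` of the domain whose transversal is `{x, x'}`. -/
def fixSet (α : BrauerGraph X) : Set X := {x | α.graph.Adj (Sum.inl x) (Sum.inr x)}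

/-- The number of points of the upper row outside all transversals. -/
def defect (α : BrauerGraph X) : Cardinal.{u} := Cardinal.mk ↥(α.dom)ᶜ

/-- The number of points of the lower row outside all transversals. -/
def codefect (α : BrauerGraph X) : Cardinal.{u} := Cardinal.mk ↥(α.codom)ᶜ

/-- The number of points that are not fixed. -/
def supp (α : BrauerGraph X) : Cardinal.{u} := Cardinal.mk ↥(α.fixSet)ᶜ

/-- The number of points of the domain that are not fixed. -/
def shift (α : BrauerGraph X) : Cardinal.{u} := Cardinal.mk ↥(α.dom \ α.fixSet)

end BrauerGraph

/-- The subsemigroup generated by all idempotents. In a monoid it contains the identity, which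
is an idempotent, so it is also the submonoid generated by all idempotents. -/
def idempotentGenerated (S : Type u) [Semigroup S] : Subsemigroup S :=
  Subsemigroup.closure {a : S | IsIdempotentElem a}

/-!
Every product of idempotents in the partial Brauer monoid on an infinite set is recognized by its
cardinal invariants.

*Products of idempotents are balanced.* If `α` is idempotent and `{x, y'}` is a transversal with
`x ≠ y`, then `y` is outside the domain and `x` outside the codomain, as otherwise squaring would
give `x` a second partner; so the shift is at most the defect and at most the codefect. As
`supp = def + sh = codef + sh`, this leaves two cases: the support is finite, or it is infinite and
equal to the defect and the codefect. A finite support with defect at most one forces shift zero,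
because the path from `x` to `y'` in the square has to use a hook at `y`. These conditions
(`Balanced`) pass to products (`Balanced.mul`): supports are subadditive, `def (α * β) ≥ def α`, and
`def β` exceeds `def (α * β)` by at most `2 * supp α`, with the dual facts for codefects.

*Balanced elements are products of idempotents.* An element without shift is idempotent. Multiplying
by such elements on both sides cuts down transversals and installs arbitrary hooks, so it suffices
to realize the transversals (`mem_of_transversals`). A product of two projections moves a family of
points `s i` to free places `t i`, provided that there are further free places `a i`
(`exists_move`). For finite support and defect at least two, moved points are brought home one at a
time (`realizable_of_finite`); for infinite defect, three simultaneous moves through the complements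
of the domain and the codomain do (`realizable_of_infinite`).
-/

namespace BrauerGraph

variable {X : Type u}

/-! ### Products -/

theorem prodGraph_adj_top {α : BrauerGraph X} (β : BrauerGraph X) {v w : X ⊕ X}
    (h : α.graph.Adj v w) : (prodGraph α β).Adj (topTwo v) (topTwo w) :=
  (prodGraph_adj ..).2 (Or.inl ⟨v, w, rfl, rfl, h⟩)

theorem prodGraph_adj_bottom (α : BrauerGraph X) {β : BrauerGraph X} {v w : X ⊕ X}
    (h : β.graph.Adj v w) : (prodGraph α β).Adj (bottomTwo v) (bottomTwo w) :=
  (prodGraph_adj ..).2 (Or.inr ⟨v, w, rfl, rfl, h⟩)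

theorem prodGraph_adj_upper {α β : BrauerGraph X} {x : X} {b : ProdVertex X} :
    (prodGraph α β).Adj (.upper x) b ↔ ∃ w, topTwo w = b ∧ α.graph.Adj (.inl x) w := by
  rw [prodGraph_adj]
  constructor
  · rintro (⟨v, w, h, rfl, hvw⟩ | ⟨v | v, w, h, -, -⟩)
    · obtain rfl : v = .inl x := topTwo_injective h
      exact ⟨w, rfl, hvw⟩
    all_goals simp [bottomTwo] at h
  · rintro ⟨w, rfl, h⟩
    exact Or.inl ⟨_, w, rfl, rfl, h⟩

theorem prodGraph_adj_lower {α β : BrauerGraph X} {x : X} {b : ProdVertex X} :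
    (prodGraph α β).Adj (.lower x) b ↔ ∃ w, bottomTwo w = b ∧ β.graph.Adj (.inr x) w := by
  rw [prodGraph_adj]
  constructor
  · rintro (⟨v | v, w, h, -, -⟩ | ⟨v, w, h, rfl, hvw⟩)
    · simp [topTwo] at h
    · simp [topTwo] at h
    · obtain rfl : v = .inr x := bottomTwo_injective h
      exact ⟨w, rfl, hvw⟩
  · rintro ⟨w, rfl, h⟩
    exact Or.inr ⟨_, w, rfl, rfl, h⟩

theorem prodGraph_adj_middle {α β : BrauerGraph X} {x : X} {b : ProdVertex X} :
    (prodGraph α β).Adj (.middle x) b ↔ (∃ w, topTwo w = b ∧ α.graph.Adj (.inr x) w) ∨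
      (∃ w, bottomTwo w = b ∧ β.graph.Adj (.inl x) w) := by
  rw [prodGraph_adj]
  constructor
  · rintro (⟨v, w, h, rfl, hvw⟩ | ⟨v, w, h, rfl, hvw⟩)
    · obtain rfl : v = .inr x := topTwo_injective h
      exact Or.inl ⟨w, rfl, hvw⟩
    · obtain rfl : v = .inl x := bottomTwo_injective h
      exact Or.inr ⟨w, rfl, hvw⟩
  · rintro (⟨w, rfl, h⟩ | ⟨w, rfl, h⟩)
    · exact Or.inl ⟨_, w, rfl, rfl, h⟩
    · exact Or.inr ⟨_, w, rfl, rfl, h⟩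

theorem mem_of_reachable {V : Type u} {G : SimpleGraph V} {S : Set V}
    (hS : ∀ a ∈ S, ∀ b, G.Adj a b → b ∈ S) {a b : V} (h : G.Reachable a b) (ha : a ∈ S) :
    b ∈ S := by
  rw [SimpleGraph.reachable_iff_reflTransGen] at h
  induction h with
  | refl => exact ha
  | tail _ hab ih => exact hS _ ih _ hab

theorem mul_adj_transversal {α β : BrauerGraph X} {x y z : X}
    (h₁ : α.graph.Adj (.inl x) (.inr y)) (h₂ : β.graph.Adj (.inl y) (.inr z)) :
    (α * β).graph.Adj (.inl x) (.inr z) :=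
  (mul_adj ..).2 ⟨by simp,
    (prodGraph_adj_top β h₁).reachable.trans (prodGraph_adj_bottom α h₂).reachable⟩

theorem mul_adj_upper {α : BrauerGraph X} (β : BrauerGraph X) {x y : X}
    (h : α.graph.Adj (.inl x) (.inl y)) : (α * β).graph.Adj (.inl x) (.inl y) :=
  (mul_adj ..).2 ⟨h.ne, (prodGraph_adj_top β h).reachable⟩

theorem mul_adj_lower (α : BrauerGraph X) {β : BrauerGraph X} {x y : X}
    (h : β.graph.Adj (.inr x) (.inr y)) : (α * β).graph.Adj (.inr x) (.inr y) :=
  (mul_adj ..).2 ⟨h.ne, (prodGraph_adj_bottom α h).reachable⟩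

theorem not_mul_adj_upper {α : BrauerGraph X} (β : BrauerGraph X) {x : X}
    (h : ∀ w, ¬α.graph.Adj (.inl x) w) (w : X ⊕ X) : ¬(α * β).graph.Adj (.inl x) w := by
  rintro ⟨hne, hr⟩
  have := mem_of_reachable (S := {ProdVertex.upper x}) ?_ hr rfl
  · exact hne (outerTwo_injective (Set.mem_singleton_iff.1 this).symm)
  · rintro a rfl b hb
    obtain ⟨w, -, hw⟩ := prodGraph_adj_upper.1 hb
    exact absurd hw (h w)

theorem not_mul_adj_lower (α : BrauerGraph X) {β : BrauerGraph X} {x : X}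
    (h : ∀ w, ¬β.graph.Adj (.inr x) w) (w : X ⊕ X) : ¬(α * β).graph.Adj (.inr x) w := by
  rintro ⟨hne, hr⟩
  have := mem_of_reachable (S := {ProdVertex.lower x}) ?_ hr rfl
  · exact hne (outerTwo_injective (Set.mem_singleton_iff.1 this).symm)
  · rintro a rfl b hb
    obtain ⟨w, -, hw⟩ := prodGraph_adj_lower.1 hb
    exact absurd hw (h w)

/-- As degrees are at most one, two Brauer graphs agree once the first is contained in the second
and has no more isolated vertices. -/
theorem eq_of_adj_of_isolated {α β : BrauerGraph X}
    (h₁ : ∀ v w, α.graph.Adj v w → β.graph.Adj v w)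
    (h₂ : ∀ v, (∀ w, ¬α.graph.Adj v w) → ∀ w, ¬β.graph.Adj v w) : α = β := by
  ext v w
  refine ⟨h₁ v w, fun h => ?_⟩
  by_contra hn
  refine h₂ v (fun w' hw' => ?_) w h
  rw [β.eq_of_adj h (h₁ _ _ hw')] at hn
  exact hn hw'

theorem eq_of_adj_left {α : BrauerGraph X} {x x' y : X} (h : α.graph.Adj (.inl x) (.inr y))
    (h' : α.graph.Adj (.inl x') (.inr y)) : x = x' :=
  Sum.inl_injective (α.eq_of_adj h.symm h'.symm)

theorem eq_of_adj_right {α : BrauerGraph X} {x y y' : X} (h : α.graph.Adj (.inl x) (.inr y))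
    (h' : α.graph.Adj (.inl x) (.inr y')) : y = y' :=
  Sum.inr_injective (α.eq_of_adj h h')

theorem dom_mul_subset (α β : BrauerGraph X) : (α * β).dom ⊆ α.dom := by
  rintro x ⟨y, h⟩
  by_contra hx
  refine not_mul_adj_upper β (α := α) (x := x) ?_ _ h
  rintro (z | z) hz
  · exact Sum.inl_ne_inr ((α * β).eq_of_adj (mul_adj_upper β hz) h)
  · exact hx ⟨z, hz⟩

theorem codom_mul_subset (α β : BrauerGraph X) : (α * β).codom ⊆ β.codom := by
  rintro y ⟨x, h⟩
  by_contra hy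
  refine not_mul_adj_lower α (β := β) (x := y) ?_ _ h.symm
  rintro (z | z) hz
  · exact hy ⟨z, hz.symm⟩
  · exact Sum.inl_ne_inr ((α * β).eq_of_adj h.symm (mul_adj_lower α hz))

theorem fixSet_subset_dom (α : BrauerGraph X) : α.fixSet ⊆ α.dom := fun x h => ⟨x, h⟩

theorem fixSet_subset_codom (α : BrauerGraph X) : α.fixSet ⊆ α.codom := fun x h => ⟨x, h⟩

theorem fixSet_inter_subset_fixSet_mul (α β : BrauerGraph X) :
    α.fixSet ∩ β.fixSet ⊆ (α * β).fixSet := fun _ h => mul_adj_transversal h.1 h.2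

theorem eq_of_shift_eq_zero {α : BrauerGraph X} (h : α.shift = 0) {x y : X}
    (hxy : α.graph.Adj (.inl x) (.inr y)) : x = y := by
  have h' : x ∈ α.fixSet := by
    by_contra hx
    have hmem : x ∈ α.dom \ α.fixSet := ⟨⟨y, hxy⟩, hx⟩
    exact (Cardinal.mk_set_eq_zero_iff.1 h).subset hmem
  exact eq_of_adj_right h' hxy

theorem shift_eq_zero {α : BrauerGraph X}
    (h : ∀ x y, α.graph.Adj (.inl x) (.inr y) → x = y) : α.shift = 0 := by
  refine Cardinal.mk_set_eq_zero_iff.2 (Set.eq_empty_of_forall_notMem ?_)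
  rintro x ⟨⟨y, hy⟩, hx⟩
  obtain rfl := h _ _ hy
  exact hx hy

/-- If no transversal moves a point, then squaring changes nothing: the hooks between the two
copies meet no transversal. -/
theorem isIdempotentElem_of_shift_eq_zero {α : BrauerGraph X} (h : α.shift = 0) :
    IsIdempotentElem α := by
  refine (eq_of_adj_of_isolated ?_ ?_).symm
  · rintro (x | x) (y | y) hxy
    · exact mul_adj_upper α hxy
    · obtain rfl := eq_of_shift_eq_zero h hxy
      exact mul_adj_transversal hxy hxy
    · obtain rfl := eq_of_shift_eq_zero h hxy.symm
      exact (mul_adj_transversal hxy.symm hxy.symm).symm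
    · exact mul_adj_lower α hxy
  · rintro (x | x) hx
    · exact not_mul_adj_upper α hx
    · exact not_mul_adj_lower α hx

theorem mem_of_shift_eq_zero {α : BrauerGraph X} (h : α.shift = 0) :
    α ∈ idempotentGenerated (BrauerGraph X) :=
  Subsemigroup.subset_closure (isIdempotentElem_of_shift_eq_zero h)

/-! ### Brauer graphs without shift -/

/-- The Brauer graph with upper hooks `u`, lower hooks `l` and transversals `{x, x'}` for `x ∈ D`. -/
def ofHooks (u l : SimpleGraph X) (D : Set X)
    (hu : ∀ x y z, u.Adj x y → u.Adj x z → y = z) (hl : ∀ x y z, l.Adj x y → l.Adj x z → y = z)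
    (hDu : ∀ x ∈ D, ∀ y, ¬u.Adj x y) (hDl : ∀ x ∈ D, ∀ y, ¬l.Adj x y) : BrauerGraph X where
  graph :=
    { Adj := fun v w => match v, w with
        | .inl x, .inl y => u.Adj x y
        | .inr x, .inr y => l.Adj x y
        | .inl x, .inr y => x = y ∧ x ∈ D
        | .inr x, .inl y => x = y ∧ x ∈ D
      symm := ⟨by
        rintro (x | x) (y | y) h
        · exact h.symm
        · exact ⟨h.1.symm, h.1 ▸ h.2⟩
        · exact ⟨h.1.symm, h.1 ▸ h.2⟩
        · exact h.symm⟩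
      loopless := ⟨by
        rintro (x | x) h
        · exact u.loopless.irrefl _ h
        · exact l.loopless.irrefl _ h⟩ }
  eq_of_adj := by
    rintro (x | x) (y | y) (z | z) h h'
    · exact congrArg _ (hu _ _ _ h h')
    · exact absurd h (hDu _ h'.2 _)
    · exact absurd h' (hDu _ h.2 _)
    · exact congrArg _ (h.1.symm.trans h'.1)
    · exact congrArg _ (h.1.symm.trans h'.1)
    · exact absurd h' (hDl _ h.2 _)
    · exact absurd h (hDl _ h'.2 _)
    · exact congrArg _ (hl _ _ _ h h')

theorem ofHooks_mem (u l : SimpleGraph X) (D : Set X) (hu hl hDu hDl) :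
    ofHooks u l D hu hl hDu hDl ∈ idempotentGenerated (BrauerGraph X) :=
  mem_of_shift_eq_zero (shift_eq_zero fun _ _ h => h.1)

/-- Only the transversals of `α` matter for membership in the idempotent-generated subsemigroup:
multiplying `π` by suitable idempotents on both sides cuts its transversals down to those of `α`
and installs the hooks of `α`. -/
theorem mem_of_transversals {α π : BrauerGraph X} (hπ : π ∈ idempotentGenerated (BrauerGraph X))
    (h : ∀ x y, α.graph.Adj (.inl x) (.inr y) → π.graph.Adj (.inl x) (.inr y)) :
    α ∈ idempotentGenerated (BrauerGraph X) := by
  let l : BrauerGraph X := ofHooks (α.graph.comap Sum.inl) ⊥ α.dom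
    (fun x y z h h' => Sum.inl_injective (α.eq_of_adj h h')) (fun _ _ _ h => h.elim)
    (fun x ⟨y, h⟩ z h' => Sum.inl_ne_inr (α.eq_of_adj h' h)) (fun _ _ _ h => h.elim)
  let r : BrauerGraph X := ofHooks ⊥ (α.graph.comap Sum.inr) α.codom
    (fun _ _ _ h => h.elim) (fun x y z h h' => Sum.inr_injective (α.eq_of_adj h h'))
    (fun _ _ _ h => h.elim) (fun x ⟨y, h⟩ z h' => Sum.inl_ne_inr (α.eq_of_adj h.symm h'))
  have key : α = l * π * r := by
    have hlr : ∀ x y, α.graph.Adj (.inl x) (.inr y) →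
        (l * π * r).graph.Adj (.inl x) (.inr y) := fun x y hxy =>
      mul_adj_transversal (mul_adj_transversal (α := l) (y := x) ⟨rfl, y, hxy⟩ (h x y hxy))
        ⟨rfl, x, hxy⟩
    refine eq_of_adj_of_isolated ?_ ?_
    · rintro (x | x) (y | y) hxy
      · exact mul_adj_upper r (mul_adj_upper π (α := l) hxy)
      · exact hlr x y hxy
      · exact (hlr y x hxy.symm).symm
      · exact mul_adj_lower _ (β := r) hxy
    · rintro (x | x) hx
      · refine not_mul_adj_upper r (not_mul_adj_upper π ?_)
        rintro (w | w) hw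
        · exact hx _ hw
        · obtain ⟨y, hy⟩ := hw.2
          exact hx _ hy
      · refine not_mul_adj_lower _ ?_
        rintro (w | w) hw
        · obtain ⟨y, hy⟩ := hw.2
          exact hx _ hy.symm
        · exact hx _ hw
  rw [key]
  exact mul_mem (mul_mem (ofHooks_mem _ _ _ _ _ _ _) hπ) (ofHooks_mem _ _ _ _ _ _ _)

/-! ### Moving points by idempotents -/

/-- The projection attached to an involution `σ`: it fixes the fixed points of `σ`, and the other
orbits of `σ` are its upper and its lower hooks. -/
def hookId (σ : Equiv.Perm X) (hσ : ∀ x, σ (σ x) = x) : BrauerGraph X :=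
  let G : SimpleGraph X :=
    { Adj := fun x y => σ x = y ∧ x ≠ y
      symm := ⟨by rintro x y ⟨rfl, h⟩; exact ⟨hσ x, h.symm⟩⟩
      loopless := ⟨fun _ h => h.2 rfl⟩ }
  ofHooks G G {x | σ x = x} (fun _ _ _ h h' => h.1.symm.trans h'.1)
    (fun _ _ _ h h' => h.1.symm.trans h'.1) (fun _ hx _ h => h.2 (hx.symm.trans h.1))
    (fun _ hx _ h => h.2 (hx.symm.trans h.1))

theorem hookId_mem (σ : Equiv.Perm X) (hσ : ∀ x, σ (σ x) = x) :
    hookId σ hσ ∈ idempotentGenerated (BrauerGraph X) :=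
  mem_of_shift_eq_zero (shift_eq_zero fun _ _ h => h.1)

/-- The involution that exchanges `f i` and `g i`. -/
theorem exists_involution_swap {I : Type u} {f g : I → X}
    (h : Function.Injective (Sum.elim f g)) : ∃ σ : Equiv.Perm X, (∀ x, σ (σ x) = x) ∧
      (∀ i, σ (f i) = g i) ∧ (∀ i, σ (g i) = f i) ∧
      ∀ x, x ∉ Set.range f → x ∉ Set.range g → σ x = x := by
  let e : I ⊕ I ↪ X := ⟨Sum.elim f g, h⟩
  have he : ∀ v, (Equiv.Perm.viaEmbedding (Equiv.sumComm I I) e) (e v) = e v.swap := fun v =>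
    Equiv.Perm.viaEmbedding_apply _ _ v
  have hn : ∀ x ∉ Set.range e, (Equiv.Perm.viaEmbedding (Equiv.sumComm I I) e) x = x :=
    fun x hx => Equiv.Perm.viaEmbedding_apply_of_notMem _ _ x hx
  refine ⟨Equiv.Perm.viaEmbedding (Equiv.sumComm I I) e, fun x => ?_, fun i => he (.inl i),
    fun i => he (.inr i), fun x hf hg => hn x ?_⟩
  · by_cases hx : x ∈ Set.range e
    · obtain ⟨v, rfl⟩ := hx
      rw [he, he, Sum.swap_swap]
    · rw [hn x hx, hn x hx]
  · rintro ⟨i | i, rfl⟩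
    · exact hf ⟨i, rfl⟩
    · exact hg ⟨i, rfl⟩

/-- A product of two projections moves each `s i` to `t i`, with the help of the free points
`a i`: in the product graph `s i` runs along the upper hook `{s i, a i}` of the second factor and
the lower hook `{a i, t i}` of the first. -/
theorem exists_move {I : Type u} {s t a : I → X} (hs : Function.Injective s)
    (ht : Function.Injective t) (ha : Function.Injective a) (hst : ∀ i j, s i ≠ t j)
    (hsa : ∀ i j, s i ≠ a j) (hta : ∀ i j, t i ≠ a j) :
    ∃ π ∈ idempotentGenerated (BrauerGraph X), (∀ i, π.graph.Adj (.inl (s i)) (.inr (t i))) ∧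
      ∀ x, x ∉ Set.range s → x ∉ Set.range t → x ∉ Set.range a →
        π.graph.Adj (.inl x) (.inr x) := by
  obtain ⟨σ, hσ, hσt, hσa, hσn⟩ := exists_involution_swap (ht.sumElim ha hta)
  obtain ⟨τ, hτ, hτs, hτa, hτn⟩ := exists_involution_swap (hs.sumElim ha hsa)
  refine ⟨hookId σ hσ * hookId τ hτ, mul_mem (hookId_mem σ hσ) (hookId_mem τ hτ), fun i => ?_,
    fun x hxs hxt hxa => ?_⟩
  · have h₁ : (hookId σ hσ).graph.Adj (.inl (s i)) (.inr (s i)) := by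
      refine ⟨rfl, hσn _ ?_ ?_⟩
      · rintro ⟨j, hj⟩; exact hst i j hj.symm
      · rintro ⟨j, hj⟩; exact hsa i j hj.symm
    have h₂ : (hookId τ hτ).graph.Adj (.inl (s i)) (.inl (a i)) := ⟨hτs i, hsa i i⟩
    have h₃ : (hookId σ hσ).graph.Adj (.inr (a i)) (.inr (t i)) := ⟨hσa i, (hta i i).symm⟩
    have h₄ : (hookId τ hτ).graph.Adj (.inl (t i)) (.inr (t i)) := by
      refine ⟨rfl, hτn _ ?_ ?_⟩
      · rintro ⟨j, hj⟩; exact hst j i hj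
      · rintro ⟨j, hj⟩; exact hta i j hj.symm
    exact (mul_adj ..).2 ⟨by simp, ((prodGraph_adj_top _ h₁).reachable.trans
      (prodGraph_adj_bottom _ h₂).reachable).trans ((prodGraph_adj_top _ h₃).reachable.trans
      (prodGraph_adj_bottom _ h₄).reachable)⟩
  · exact mul_adj_transversal ⟨rfl, hσn x hxt hxa⟩ ⟨rfl, hτn x hxs hxa⟩

/-! ### Idempotent-generated elements of finite support -/

/-- Some product of idempotents has the transversals `{x, (f x)'}` for all `x ∈ D`. -/
def Realizable (D : Set X) (f : X → X) : Prop :=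
  ∃ π ∈ idempotentGenerated (BrauerGraph X), ∀ x ∈ D, π.graph.Adj (.inl x) (.inr (f x))

theorem realizable_of_fixed {D : Set X} {f : X → X} (h : ∀ x ∈ D, f x = x) : Realizable D f :=
  ⟨1, Subsemigroup.subset_closure (one_mul 1), fun x hx =>
    (one_adj ..).2 ⟨by simp [h x hx], by simp⟩⟩

/-- A single point `x` of the domain may first be moved to a free place `y`, as long as there is
a second free place `a`. -/
theorem Realizable.of_move {D : Set X} {f g : X → X} {x y a : X} (hx : x ∈ D) (hy : y ∉ D)
    (ha : a ∉ D) (hya : y ≠ a) (hgy : g y = f x) (hg : ∀ z ∈ D, z ≠ x → g z = f z)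
    (h : Realizable (insert y (D \ {x})) g) : Realizable D f := by
  have hxy : x ≠ y := fun e => hy (e ▸ hx)
  have hxa : x ≠ a := fun e => ha (e ▸ hx)
  obtain ⟨ρ, hρ, hρD⟩ := h
  obtain ⟨π, hπ, h₁, h₂⟩ := exists_move (I := PUnit) (s := fun _ => x) (t := fun _ => y)
    (a := fun _ => a) (fun _ _ _ => rfl) (fun _ _ _ => rfl) (fun _ _ _ => rfl) (fun _ _ => hxy)
    (fun _ _ => hxa) (fun _ _ => hya)
  refine ⟨π * ρ, mul_mem hπ hρ, fun z hz => ?_⟩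
  by_cases hzx : z = x
  · subst hzx
    rw [← hgy]
    exact mul_adj_transversal (h₁ ⟨⟩) (hρD y (Set.mem_insert _ _))
  · rw [← hg z hz hzx]
    refine mul_adj_transversal (h₂ z ?_ ?_ ?_) (hρD z (Set.mem_insert_of_mem _ ⟨hz, hzx⟩))
    · rintro ⟨_, h⟩; exact hzx h.symm
    · rintro ⟨_, rfl⟩; exact hy hz
    · rintro ⟨_, rfl⟩; exact ha hz

/-- An injection that moves finitely many points is realizable when its domain misses two points.
Each round brings one more point home, after clearing its target if that is occupied. -/
theorem realizable_of_finite {D : Set X} {f : X → X} (hf : Set.InjOn f D)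
    (hfin : {x ∈ D | f x ≠ x}.Finite) {c d : X} (hc : c ∉ D) (hd : d ∉ D) (hcd : c ≠ d) :
    Realizable D f := by
  classical
  induction hn : {x ∈ D | f x ≠ x}.ncard using Nat.strong_induction_on generalizing D f c d with
  | _ n ih =>
  subst hn
  by_cases hmov : ∀ x ∈ D, f x = x
  · exact realizable_of_fixed hmov
  push Not at hmov
  obtain ⟨x, hx, hfx⟩ := hmov
  -- The case of a free target; it is also the second half of a round in the other case.
  have free : ∀ (E : Set X) (g : X → X), Set.InjOn g E → {z ∈ E | g z ≠ z}.Finite →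
      {z ∈ E | g z ≠ z}.ncard ≤ {z ∈ D | f z ≠ z}.ncard → x ∈ E → g x = f x → f x ∉ E →
      ∀ a ∉ E, f x ≠ a → Realizable E g := by
    intro E g hg hgfin hcard hxE hgx hy a ha hya
    have hgz : ∀ z ∈ E, z ≠ x → g z ≠ f x := fun z hz hzx e =>
      hzx (hg hz hxE (e.trans hgx.symm))
    have hupd : ∀ z ∈ E, Function.update g (f x) (f x) z = g z := fun z hz =>
      Function.update_of_ne (fun e : z = f x => hy (e ▸ hz)) _ _
    refine Realizable.of_move hxE hy ha hya (g := Function.update g (f x) (f x))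
      (by simp [hgx]) (fun z hz _ => hupd z hz) ?_
    have hsub : {z ∈ insert (f x) (E \ {x}) | Function.update g (f x) (f x) z ≠ z} ⊂
        {z ∈ E | g z ≠ z} := by
      refine (Set.ssubset_iff_of_subset ?_).2 ⟨x, ⟨hxE, hgx ▸ hfx⟩, ?_⟩
      · rintro z ⟨rfl | ⟨hz, -⟩, h⟩
        · simp at h
        · exact ⟨hz, hupd z hz ▸ h⟩
      · rintro ⟨h | h, -⟩
        · exact hfx h.symm
        · exact h.2 rfl
    refine ih _ ((Set.ncard_lt_ncard hsub hgfin).trans_le hcard) ?_ (hgfin.subset hsub.subset)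
      (c := x) (d := a) ?_ ?_ (fun e => ha (e ▸ hxE)) rfl
    · rintro z (rfl | hz) w (rfl | hw) h
      · rfl
      · rw [hupd w hw.1, Function.update_self] at h
        exact absurd h.symm (hgz w hw.1 hw.2)
      · rw [hupd z hz.1, Function.update_self] at h
        exact absurd h (hgz z hz.1 hz.2)
      · rw [hupd z hz.1, hupd w hw.1] at h
        exact hg hz.1 hw.1 h
    · rintro (h | h)
      · exact hfx h.symm
      · exact h.2 rfl
    · rintro (h | h)
      · exact hya h.symm
      · exact ha h.1
  by_cases hy : f x ∈ D
  · -- The target `f x` is occupied: its occupant first goes to `c`.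
    have hyx : f (f x) ≠ f x := fun e => hfx (hf hy hx e)
    have hcy : c ≠ f x := fun e => hc (e ▸ hy)
    have hupd : ∀ z ∈ D, Function.update f c (f (f x)) z = f z := fun z hz =>
      Function.update_of_ne (fun e : z = c => hc (e ▸ hz)) _ _
    have hgy : ∀ z ∈ D, z ≠ f x → f z ≠ f (f x) := fun z hz hzy e => hzy (hf hz hy e)
    have hsub : {z ∈ insert c (D \ {f x}) | Function.update f c (f (f x)) z ≠ z} ⊆
        insert c ({z ∈ D | f z ≠ z} \ {f x}) := by
      rintro z ⟨rfl | ⟨hz, hzy⟩, h⟩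
      · exact Set.mem_insert _ _
      · exact Set.mem_insert_of_mem _ ⟨⟨hz, hupd z hz ▸ h⟩, hzy⟩
    refine Realizable.of_move hy hc hd hcd (g := Function.update f c (f (f x))) (by simp)
      (fun z hz _ => hupd z hz) (free _ _ ?_ ((hfin.sdiff.insert c).subset hsub) ?_
        (Set.mem_insert_of_mem _ ⟨hx, hfx.symm⟩) (hupd x hx) ?_ d ?_ fun e => hd (e ▸ hy))
    · rintro z (rfl | hz) w (rfl | hw) h
      · rfl
      · rw [hupd w hw.1, Function.update_self] at h
        exact absurd h.symm (hgy w hw.1 hw.2)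
      · rw [hupd z hz.1, Function.update_self] at h
        exact absurd h (hgy z hz.1 hz.2)
      · rw [hupd z hz.1, hupd w hw.1] at h
        exact hf hz.1 hw.1 h
    · refine (Set.ncard_le_ncard hsub (hfin.sdiff.insert c)).trans ?_
      refine (Set.ncard_insert_le _ _).trans ?_
      rw [Set.ncard_sdiff_singleton_add_one (show f x ∈ {z ∈ D | f z ≠ z} from ⟨hy, hyx⟩) hfin]
    · rintro (h | h)
      · exact hcy h.symm
      · exact h.2 rfl
    · rintro (h | h)
      · exact hcd h.symm
      · exact hd h.1
  · by_cases hyc : f x = c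
    · exact free D f hf hfin le_rfl hx rfl hy d hd (hyc ▸ hcd)
    · exact free D f hf hfin le_rfl hx rfl hy c hc hyc

/-! ### Idempotent-generated elements of infinite defect -/

/-- Two sets of the same infinite cardinality have room for disjoint copies of any index type that
is not larger. -/
theorem exists_injective_sumElim {J : Type u} {A B : Set X} {κ : Cardinal.{u}}
    (hκ : Cardinal.aleph0 ≤ κ) (hA : Cardinal.mk A = κ) (hB : Cardinal.mk B = κ)
    (hJ : Cardinal.mk J ≤ κ) : ∃ p q : J → X, Function.Injective (Sum.elim p q) ∧
      (∀ j, p j ∈ A) ∧ ∀ j, q j ∈ B := by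
  by_cases h : Cardinal.mk ↥(A ∩ B) < κ
  · have h' : κ ≤ Cardinal.mk ↥(A \ B) := by
      by_contra! hlt
      refine (Cardinal.add_lt_of_lt hκ hlt h).not_ge ?_
      rw [← hA]
      refine le_trans (le_of_eq ?_) (Cardinal.mk_union_le (A \ B) (A ∩ B))
      rw [Set.sdiff_union_inter]
    obtain ⟨p⟩ := (Cardinal.le_def _ _).1 (hJ.trans h')
    obtain ⟨q⟩ := (Cardinal.le_def _ _).1 (hJ.trans hB.ge)
    refine ⟨fun j => p j, fun j => q j,
      (Subtype.val_injective.comp p.injective).sumElim (Subtype.val_injective.comp q.injective) ?_,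
      fun j => (p j).2.1, fun j => (q j).2⟩
    intro i j (e : (p i : X) = q j)
    refine (p i).2.2 ?_
    rw [e]
    exact (q j).2
  · have h' : Cardinal.mk (J ⊕ J) ≤ Cardinal.mk ↥(A ∩ B) := by
      rw [Cardinal.mk_sum, Cardinal.lift_id]
      exact (Cardinal.add_le_of_le hκ hJ hJ).trans (not_lt.1 h)
    obtain ⟨p⟩ := (Cardinal.le_def _ _).1 h'
    refine ⟨fun j => p (.inl j), fun j => p (.inr j), ?_, fun j => (p _).2.1, fun j => (p _).2.2⟩
    convert Subtype.val_injective.comp p.injective using 1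
    ext (j | j) <;> rfl

/-- With infinite defect and codefect of at least the size of the shift, three moves suffice: the
moved points `M` go to a part `P` of the complement of the domain, then to a part `R` of the
complement of the codomain, and from there to their targets. Disjoint parts `P₂` and `R₂` of the
same size provide the free places for these moves. -/
theorem realizable_of_infinite {D : Set X} {f : X → X} (hf : Set.InjOn f D) {κ : Cardinal.{u}}
    (hκ : Cardinal.aleph0 ≤ κ) (hA : Cardinal.mk ↥Dᶜ = κ) (hB : Cardinal.mk ↥(f '' D)ᶜ = κ)
    (hM : Cardinal.mk ↥{x ∈ D | f x ≠ x} ≤ κ) : Realizable D f := by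
  set M : Set X := {x ∈ D | f x ≠ x} with hMdef
  obtain ⟨p, r, hpr, hpA, hrB⟩ := exists_injective_sumElim (J := M ⊕ M) hκ hA hB (by
    rw [Cardinal.mk_sum, Cardinal.lift_id]
    exact Cardinal.add_le_of_le hκ hM hM)
  have hp : Function.Injective p := hpr.comp Sum.inl_injective
  have hr : Function.Injective r := hpr.comp Sum.inr_injective
  have hprn : ∀ i j, p i ≠ r j := fun i j e => Sum.inl_ne_inr (hpr (show Sum.elim p r (.inl i) =
    Sum.elim p r (.inr j) from e))
  have hpn : ∀ i, ∀ x ∈ D, x ≠ p i := fun i x hx e => hpA i (e ▸ hx)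
  have hrn : ∀ i, ∀ x ∈ D, r i ≠ f x := fun i x hx e => hrB i (e ▸ ⟨x, hx, rfl⟩)
  have hinj : Function.Injective fun m : M => f m := fun m n e =>
    Subtype.ext (hf m.2.1 n.2.1 e)
  obtain ⟨π₁, hπ₁, h₁, k₁⟩ := exists_move (s := fun m : M => (m : X)) (t := fun m => p (.inl m))
    (a := fun m => p (.inr m)) Subtype.val_injective (hp.comp Sum.inl_injective)
    (hp.comp Sum.inr_injective) (fun m _ => hpn _ m m.2.1) (fun m _ => hpn _ m m.2.1)
    (fun _ _ e => Sum.inl_ne_inr (hp e))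
  obtain ⟨π₂, hπ₂, h₂, k₂⟩ := exists_move (s := fun m : M => p (.inl m)) (t := fun m => r (.inl m))
    (a := fun m => p (.inr m)) (hp.comp Sum.inl_injective) (hr.comp Sum.inl_injective)
    (hp.comp Sum.inr_injective) (fun _ _ => hprn _ _) (fun _ _ e => Sum.inl_ne_inr (hp e))
    (fun _ _ e => hprn _ _ e.symm)
  obtain ⟨π₃, hπ₃, h₃, k₃⟩ := exists_move (s := fun m : M => r (.inl m)) (t := fun m => f m)
    (a := fun m => r (.inr m)) (hr.comp Sum.inl_injective) hinj (hr.comp Sum.inr_injective)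
    (fun _ m => hrn _ m m.2.1) (fun _ _ e => Sum.inl_ne_inr (hr e))
    (fun m _ e => hrn _ m m.2.1 e.symm)
  refine ⟨π₁ * π₂ * π₃, mul_mem (mul_mem hπ₁ hπ₂) hπ₃, fun x hx => ?_⟩
  by_cases hxM : x ∈ M
  · exact mul_adj_transversal (mul_adj_transversal (h₁ ⟨x, hxM⟩) (h₂ ⟨x, hxM⟩)) (h₃ ⟨x, hxM⟩)
  · have hfx : f x = x := by
      by_contra h
      exact hxM ⟨hx, h⟩
    have n₁ : ∀ g : M → M ⊕ M, x ∉ Set.range fun m => p (g m) := by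
      rintro g ⟨m, h⟩
      exact hpn _ x hx h.symm
    have n₂ : ∀ g : M → M ⊕ M, x ∉ Set.range fun m => r (g m) := by
      rintro g ⟨m, h⟩
      exact hrn _ x hx (h.trans hfx.symm)
    have n₃ : x ∉ Set.range fun m : M => f m := by
      rintro ⟨m, h⟩
      have : (m : X) = x := hf m.2.1 hx (h.trans hfx.symm)
      exact hxM (this ▸ m.2)
    have n₄ : x ∉ Set.range fun m : M => (m : X) := by
      rintro ⟨m, rfl⟩
      exact hxM m.2
    rw [hfx]
    exact mul_adj_transversal (mul_adj_transversal (k₁ x n₄ (n₁ _) (n₁ _)) (k₂ x (n₁ _) (n₂ _)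
      (n₁ _))) (k₃ x (n₂ _) n₃ (n₂ _))

/-- The transversals of a Brauer graph form an injective map on its domain. -/
theorem exists_transversal_map (α : BrauerGraph X) : ∃ f : X → X, Set.InjOn f α.dom ∧
    f '' α.dom = α.codom ∧ {x ∈ α.dom | f x ≠ x} = α.dom \ α.fixSet ∧
    ∀ x y, α.graph.Adj (.inl x) (.inr y) → f x = y := by
  have h : ∀ x, ∃ z, ∀ y, α.graph.Adj (.inl x) (.inr y) → z = y := by
    intro x
    by_cases hx : x ∈ α.dom
    · obtain ⟨z, hz⟩ := hx
      exact ⟨z, fun y hy => eq_of_adj_right hz hy⟩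
    · exact ⟨x, fun y hy => absurd ⟨y, hy⟩ hx⟩
  choose f hf using h
  have hf' : ∀ x ∈ α.dom, α.graph.Adj (.inl x) (.inr (f x)) := by
    rintro x ⟨y, hy⟩
    rwa [hf x y hy]
  refine ⟨f, fun x hx y hy e => eq_of_adj_left (hf' x hx) (e ▸ hf' y hy), ?_, ?_, hf⟩
  · ext y
    constructor
    · rintro ⟨x, hx, rfl⟩
      exact ⟨x, hf' x hx⟩
    · rintro ⟨x, hx⟩
      exact ⟨x, ⟨y, hx⟩, hf x y hx⟩
  · ext x
    refine and_congr_right fun hx => not_congr ⟨fun h => ?_, fun h => hf x x h⟩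
    have := hf' x hx
    rwa [h] at this

theorem mem_of_realizable {α : BrauerGraph X} {f : X → X}
    (hf : ∀ x y, α.graph.Adj (.inl x) (.inr y) → f x = y) (h : Realizable α.dom f) :
    α ∈ idempotentGenerated (BrauerGraph X) := by
  obtain ⟨π, hπ, hπD⟩ := h
  exact mem_of_transversals hπ fun x y hxy => hf x y hxy ▸ hπD x ⟨y, hxy⟩

theorem mem_of_supp_lt_aleph0 {α : BrauerGraph X} (hd : 2 ≤ α.defect)
    (hs : α.supp < Cardinal.aleph0) : α ∈ idempotentGenerated (BrauerGraph X) := by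
  obtain ⟨f, hf, -, hM, hfa⟩ := exists_transversal_map α
  obtain ⟨c, d, hcd⟩ := Cardinal.two_le_iff.1 hd
  refine mem_of_realizable hfa (realizable_of_finite hf ?_ c.2 d.2 fun e => hcd (Subtype.ext e))
  rw [hM]
  exact (Cardinal.lt_aleph0_iff_set_finite.1 hs).subset fun x hx => hx.2

theorem mem_of_defect_eq_codefect {α : BrauerGraph X} (h : α.defect = α.codefect)
    (hs : max Cardinal.aleph0 α.shift ≤ α.defect) : α ∈ idempotentGenerated (BrauerGraph X) := by
  obtain ⟨f, hf, hB, hM, hfa⟩ := exists_transversal_map α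
  refine mem_of_realizable hfa (realizable_of_infinite hf ((le_max_left _ _).trans hs) rfl ?_ ?_)
  · rw [hB]
    exact h.symm
  · rw [hM]
    exact (le_max_right _ _).trans hs

/-! ### Invariants of products of idempotents -/

theorem supp_eq_defect_add_shift (α : BrauerGraph X) : α.supp = α.defect + α.shift := by
  unfold supp defect shift
  have hdisj : Disjoint α.domᶜ (α.dom \ α.fixSet) := Set.disjoint_left.2 fun x hx h => hx h.1
  rw [← Cardinal.mk_union_of_disjoint hdisj]
  congr 2
  ext x
  have := @fixSet_subset_dom X α x
  simp only [Set.mem_compl_iff, Set.mem_union, Set.mem_sdiff]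
  tauto

theorem shift_eq_mk_codom_diff (α : BrauerGraph X) :
    α.shift = Cardinal.mk ↥(α.codom \ α.fixSet) := by
  obtain ⟨f, hf, hB, -, hfa⟩ := exists_transversal_map α
  have : f '' (α.dom \ α.fixSet) = α.codom \ α.fixSet := by
    rw [hf.image_sdiff_subset α.fixSet_subset_dom, hB]
    congr 1
    exact (Set.image_congr fun x hx => hfa x x hx).trans (Set.image_id _)
  rw [← this, Cardinal.mk_image_eq_of_injOn _ _ (hf.mono Set.sdiff_subset), shift]

theorem supp_eq_codefect_add_shift (α : BrauerGraph X) : α.supp = α.codefect + α.shift := by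
  rw [shift_eq_mk_codom_diff]
  unfold supp codefect
  have hdisj : Disjoint α.codomᶜ (α.codom \ α.fixSet) := Set.disjoint_left.2 fun x hx h => hx h.1
  rw [← Cardinal.mk_union_of_disjoint hdisj]
  congr 2
  ext x
  have := @fixSet_subset_codom X α x
  simp only [Set.mem_compl_iff, Set.mem_union, Set.mem_sdiff]
  tauto

theorem defect_le_supp (α : BrauerGraph X) : α.defect ≤ α.supp := by
  rw [supp_eq_defect_add_shift]
  exact self_le_add_right _ _

theorem codefect_le_supp (α : BrauerGraph X) : α.codefect ≤ α.supp := by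
  rw [supp_eq_codefect_add_shift]
  exact self_le_add_right _ _

theorem defect_eq_codefect {α : BrauerGraph X} (h : α.supp < Cardinal.aleph0) :
    α.defect = α.codefect := by
  have hs : α.shift < Cardinal.aleph0 := by
    refine lt_of_le_of_lt ?_ h
    rw [supp_eq_defect_add_shift]
    exact self_le_add_left _ _
  exact Cardinal.eq_of_add_eq_add_right
    (α.supp_eq_defect_add_shift.symm.trans α.supp_eq_codefect_add_shift) hs

theorem defect_le_defect_mul (α β : BrauerGraph X) : α.defect ≤ (α * β).defect :=
  Cardinal.mk_le_mk_of_subset (Set.compl_subset_compl.2 (dom_mul_subset α β))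

theorem codefect_le_codefect_mul (α β : BrauerGraph X) : β.codefect ≤ (α * β).codefect :=
  Cardinal.mk_le_mk_of_subset (Set.compl_subset_compl.2 (codom_mul_subset α β))

theorem supp_mul_le (α β : BrauerGraph X) : (α * β).supp ≤ α.supp + β.supp := by
  refine le_trans (Cardinal.mk_le_mk_of_subset ?_) (Cardinal.mk_union_le _ _)
  rw [← Set.compl_inter]
  exact Set.compl_subset_compl.2 (fixSet_inter_subset_fixSet_mul α β)

/-- The partners of points of `S` in a set of hooks are no more numerous than `S`. -/
theorem mk_partners_le {S : Set X} {R : X → X → Prop}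
    (hR : ∀ x y z, R x z → R y z → x = y) : Cardinal.mk ↥{y | ∃ z ∈ S, R y z} ≤ Cardinal.mk S := by
  choose z hz using fun y : ↥{y | ∃ z ∈ S, R y z} => y.2
  refine Cardinal.mk_le_of_injective (f := fun y => (⟨z y, (hz y).1⟩ : S)) fun y y' e => ?_
  have e' : z y = z y' := congrArg Subtype.val e
  exact Subtype.ext (hR _ _ _ (hz y).2 (e' ▸ (hz y').2))

/-- A point outside the codomain of `α` can enter the codomain of `α * β` only if `β` moves it or
its partner in `α`. -/
theorem codefect_le_codefect_mul_add (α β : BrauerGraph X) :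
    α.codefect ≤ (α * β).codefect + (β.supp + β.supp) := by
  have hsub : α.codomᶜ ⊆ (α * β).codomᶜ ∪ (β.fixSetᶜ ∪
      {y | ∃ z ∈ β.fixSetᶜ, α.graph.Adj (.inr y) (.inr z)}) := by
    intro y hy
    by_contra hn
    simp only [Set.mem_union, Set.mem_compl_iff, not_or, not_not, Set.mem_ofPred_eq,
      not_exists, not_and] at hn
    obtain ⟨⟨x, hx⟩, hyβ, hyz⟩ := hn
    have := mem_of_reachable (S := {a | ∃ z, (z = y ∨ α.graph.Adj (.inr y) (.inr z)) ∧
      (a = .middle z ∨ a = .lower z)}) ?_ hx.2.symm ⟨y, Or.inl rfl, Or.inr rfl⟩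
    · obtain ⟨z, -, h | h⟩ := this <;> cases h
    · rintro a ⟨z, hz, ha⟩ b hb
      have hzβ : z ∈ β.fixSet := by
        rcases hz with rfl | hz
        · exact hyβ
        · by_contra h
          exact hyz z h hz
      rcases ha with rfl | rfl
      · rcases prodGraph_adj_middle.1 hb with ⟨w, rfl, hw⟩ | ⟨w, rfl, hw⟩
        · rcases hz with rfl | hz
          · rcases w with w | w
            · exact absurd ⟨w, hw.symm⟩ hy
            · exact ⟨w, Or.inr hw, Or.inl rfl⟩
          · rw [α.eq_of_adj hw hz.symm]
            exact ⟨y, Or.inl rfl, Or.inl rfl⟩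
        · rw [β.eq_of_adj hw hzβ]
          exact ⟨z, hz, Or.inr rfl⟩
      · obtain ⟨w, rfl, hw⟩ := prodGraph_adj_lower.1 hb
        rw [β.eq_of_adj hw hzβ.symm]
        exact ⟨z, hz, Or.inl rfl⟩
  refine (Cardinal.mk_le_mk_of_subset hsub).trans ((Cardinal.mk_union_le _ _).trans
    (add_le_add le_rfl ((Cardinal.mk_union_le _ _).trans (add_le_add le_rfl ?_))))
  exact mk_partners_le fun x y z h h' => Sum.inr_injective (α.eq_of_adj h.symm h'.symm)

/-- A point outside the domain of `β` can enter the domain of `α * β` only if `α` moves it or its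
partner in `β`. -/
theorem defect_le_defect_mul_add (α β : BrauerGraph X) :
    β.defect ≤ (α * β).defect + (α.supp + α.supp) := by
  have hsub : β.domᶜ ⊆ (α * β).domᶜ ∪ (α.fixSetᶜ ∪
      {y | ∃ z ∈ α.fixSetᶜ, β.graph.Adj (.inl y) (.inl z)}) := by
    intro y hy
    by_contra hn
    simp only [Set.mem_union, Set.mem_compl_iff, not_or, not_not, Set.mem_ofPred_eq,
      not_exists, not_and] at hn
    obtain ⟨⟨x, hx⟩, hyα, hyz⟩ := hn
    have := mem_of_reachable (S := {a | ∃ z, (z = y ∨ β.graph.Adj (.inl y) (.inl z)) ∧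
      (a = .middle z ∨ a = .upper z)}) ?_ hx.2 ⟨y, Or.inl rfl, Or.inr rfl⟩
    · obtain ⟨z, -, h | h⟩ := this <;> cases h
    · rintro a ⟨z, hz, ha⟩ b hb
      have hzα : z ∈ α.fixSet := by
        rcases hz with rfl | hz
        · exact hyα
        · by_contra h
          exact hyz z h hz
      rcases ha with rfl | rfl
      · rcases prodGraph_adj_middle.1 hb with ⟨w, rfl, hw⟩ | ⟨w, rfl, hw⟩
        · rw [α.eq_of_adj hw hzα.symm]
          exact ⟨z, hz, Or.inr rfl⟩
        · rcases hz with rfl | hz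
          · rcases w with w | w
            · exact ⟨w, Or.inr hw, Or.inl rfl⟩
            · exact absurd ⟨w, hw⟩ hy
          · rw [β.eq_of_adj hw hz.symm]
            exact ⟨y, Or.inl rfl, Or.inl rfl⟩
      · obtain ⟨w, rfl, hw⟩ := prodGraph_adj_upper.1 hb
        rw [α.eq_of_adj hw hzα]
        exact ⟨z, hz, Or.inl rfl⟩
  refine (Cardinal.mk_le_mk_of_subset hsub).trans ((Cardinal.mk_union_le _ _).trans
    (add_le_add le_rfl ((Cardinal.mk_union_le _ _).trans (add_le_add le_rfl ?_))))
  exact mk_partners_le fun x y z h h' => Sum.inl_injective (β.eq_of_adj h.symm h'.symm)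

/-- The invariant that characterizes products of idempotents: the support is finite, without shift
if the defect is at most one, or else it is infinite and of the same size as the defect and the
codefect. -/
def Balanced (α : BrauerGraph X) : Prop :=
  (α.supp < Cardinal.aleph0 ∧ (α.defect ≤ 1 → α.shift = 0)) ∨
    (Cardinal.aleph0 ≤ α.supp ∧ α.defect = α.supp ∧ α.codefect = α.supp)

theorem balanced_iff (α : BrauerGraph X) : α.Balanced ↔ (α.defect ≤ 1 ∧ α.shift = 0) ∨
    (2 ≤ α.defect ∧ α.supp < Cardinal.aleph0) ∨
    (α.defect = α.codefect ∧ max Cardinal.aleph0 α.shift ≤ α.defect) := by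
  constructor
  · rintro (⟨hs, h⟩ | ⟨hs, hd, hc⟩)
    · rcases le_or_gt α.defect 1 with hd | hd
      · exact Or.inl ⟨hd, h hd⟩
      · exact Or.inr (Or.inl ⟨Cardinal.two_le_iff_one_lt.2 hd, hs⟩)
    · refine Or.inr (Or.inr ⟨hd.trans hc.symm, max_le (hs.trans hd.ge) ?_⟩)
      rw [hd, supp_eq_defect_add_shift]
      exact self_le_add_left _ _
  · rintro (⟨hd, hs⟩ | ⟨hd, hs⟩ | ⟨hd, hs⟩)
    · refine Or.inl ⟨?_, fun _ => hs⟩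
      rw [supp_eq_defect_add_shift, hs, add_zero]
      exact hd.trans_lt Cardinal.one_lt_aleph0
    · exact Or.inl ⟨hs, fun h => absurd (Cardinal.two_le_iff_one_lt.1 hd) h.not_gt⟩
    · have hω := (le_max_left _ _).trans hs
      have h : α.supp = α.defect := by
        rw [supp_eq_defect_add_shift]
        exact Cardinal.add_eq_left hω ((le_max_right _ _).trans hs)
      exact Or.inr ⟨hω.trans h.ge, h.symm, (hd.symm.trans h.symm)⟩

theorem eq_of_notMem_dom {α : BrauerGraph X} (h : α.defect ≤ 1) {x y : X} (hx : x ∉ α.dom)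
    (hy : y ∉ α.dom) : x = y :=
  congrArg Subtype.val ((Cardinal.le_one_iff_subsingleton.1 h).elim
    (⟨x, hx⟩ : ↥α.domᶜ) (⟨y, hy⟩ : ↥α.domᶜ))

theorem not_adj_upper_of_defect_le_one {α : BrauerGraph X} (h : α.defect ≤ 1) {x y : X} :
    ¬α.graph.Adj (.inl x) (.inl y) := by
  intro hxy
  refine hxy.ne (congrArg _ (eq_of_notMem_dom h ?_ ?_))
  · rintro ⟨z, hz⟩
    exact Sum.inl_ne_inr (α.eq_of_adj hxy hz)
  · rintro ⟨z, hz⟩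
    exact Sum.inl_ne_inr (α.eq_of_adj hxy.symm hz)

theorem notMem_dom_of_isIdempotentElem {α : BrauerGraph X} (h : IsIdempotentElem α) {x y : X}
    (hxy : α.graph.Adj (.inl x) (.inr y)) (hne : x ≠ y) : y ∉ α.dom := by
  rintro ⟨z, hz⟩
  have := mul_adj_transversal hxy hz
  rw [h.eq] at this
  obtain rfl := eq_of_adj_right hxy this
  exact hne (eq_of_adj_left hxy hz)

theorem notMem_codom_of_isIdempotentElem {α : BrauerGraph X} (h : IsIdempotentElem α) {x y : X}
    (hxy : α.graph.Adj (.inl x) (.inr y)) (hne : x ≠ y) : x ∉ α.codom := by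
  rintro ⟨z, hz⟩
  have := mul_adj_transversal hz hxy
  rw [h.eq] at this
  obtain rfl := eq_of_adj_left hxy this
  exact hne (eq_of_adj_right hz hxy)

theorem balanced_of_isIdempotentElem {α : BrauerGraph X} (h : IsIdempotentElem α) :
    α.Balanced := by
  have hc : α.shift ≤ α.codefect := by
    refine Cardinal.mk_le_mk_of_subset ?_
    rintro x ⟨⟨y, hy⟩, hx⟩
    exact notMem_codom_of_isIdempotentElem h hy fun e => hx (e ▸ hy)
  have hd : α.shift ≤ α.defect := by
    rw [shift_eq_mk_codom_diff]
    refine Cardinal.mk_le_mk_of_subset ?_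
    rintro y ⟨⟨x, hx⟩, hy⟩
    exact notMem_dom_of_isIdempotentElem h hx fun e => hy (e ▸ hx)
  rcases lt_or_ge α.supp Cardinal.aleph0 with hs | hs
  · refine Or.inl ⟨hs, fun hd1 => shift_eq_zero fun x y hxy => ?_⟩
    by_contra hne
    have hy := notMem_dom_of_isIdempotentElem h hxy hne
    -- `y` is isolated in the upper row, so the path from `x` ends at the middle copy of `y`.
    have hadj := hxy
    rw [← h.eq] at hadj
    have := mem_of_reachable (S := {.upper x, .middle y}) ?_ hadj.2 (Or.inl rfl)
    · rcases this with h | h <;> cases h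
    · rintro a (rfl | rfl) b hb
      · obtain ⟨w, rfl, hw⟩ := prodGraph_adj_upper.1 hb
        rw [α.eq_of_adj hw hxy]
        exact Or.inr rfl
      · rcases prodGraph_adj_middle.1 hb with ⟨w, rfl, hw⟩ | ⟨w | w, rfl, hw⟩
        · rw [α.eq_of_adj hw hxy.symm]
          exact Or.inl rfl
        · exact absurd hw (not_adj_upper_of_defect_le_one hd1)
        · exact absurd ⟨w, hw⟩ hy
  · refine Or.inr ⟨hs, α.defect_le_supp.antisymm ?_, α.codefect_le_supp.antisymm ?_⟩
    · by_contra! hlt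
      refine (Cardinal.add_lt_of_lt hs hlt (hd.trans_lt hlt)).ne ?_
      exact α.supp_eq_defect_add_shift.symm
    · by_contra! hlt
      refine (Cardinal.add_lt_of_lt hs hlt (hc.trans_lt hlt)).ne ?_
      exact α.supp_eq_codefect_add_shift.symm

/-- If a factor has infinite support, then the larger of the two supports is the support, the defect
and the codefect of the product. -/
theorem balanced_mul_of_aleph0_le {α β : BrauerGraph X}
    (h : (Cardinal.aleph0 ≤ α.supp ∧ β.supp ≤ α.supp ∧ α.Balanced ∧ β.Balanced) ∨
      (Cardinal.aleph0 ≤ β.supp ∧ α.supp ≤ β.supp ∧ α.Balanced ∧ β.Balanced)) :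
    (α * β).Balanced := by
  rcases h with ⟨hω, hle, hα, hβ⟩ | ⟨hω, hle, hα, hβ⟩
  · obtain ⟨-, hαd, hαc⟩ := hα.resolve_left fun h => h.1.not_ge hω
    have hs : (α * β).supp ≤ α.supp := (supp_mul_le α β).trans (Cardinal.add_eq_left hω hle).le
    have hd : α.supp ≤ (α * β).defect := hαd.ge.trans (defect_le_defect_mul α β)
    have hc : α.supp ≤ (α * β).codefect := by
      rcases hle.lt_or_eq with hlt | heq
      · by_contra! hn
        refine (Cardinal.add_lt_of_lt hω hn (Cardinal.add_lt_of_lt hω hlt hlt)).not_ge ?_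
        exact hαc.ge.trans (codefect_le_codefect_mul_add α β)
      · rw [← heq] at hω ⊢
        obtain ⟨-, -, hβc⟩ := hβ.resolve_left fun h => h.1.not_ge hω
        exact hβc.ge.trans (codefect_le_codefect_mul α β)
    exact Or.inr ⟨hω.trans (hd.trans (defect_le_supp _)),
      (defect_le_supp _).antisymm (hs.trans hd), (codefect_le_supp _).antisymm (hs.trans hc)⟩
  · obtain ⟨-, hβd, hβc⟩ := hβ.resolve_left fun h => h.1.not_ge hω
    have hs : (α * β).supp ≤ β.supp := (supp_mul_le α β).trans (Cardinal.add_eq_right hω hle).le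
    have hc : β.supp ≤ (α * β).codefect := hβc.ge.trans (codefect_le_codefect_mul α β)
    have hd : β.supp ≤ (α * β).defect := by
      rcases hle.lt_or_eq with hlt | heq
      · by_contra! hn
        refine (Cardinal.add_lt_of_lt hω hn (Cardinal.add_lt_of_lt hω hlt hlt)).not_ge ?_
        exact hβd.ge.trans (defect_le_defect_mul_add α β)
      · rw [← heq] at hω ⊢
        obtain ⟨-, hαd, -⟩ := hα.resolve_left fun h => h.1.not_ge hω
        exact hαd.ge.trans (defect_le_defect_mul α β)
    exact Or.inr ⟨hω.trans (hd.trans (defect_le_supp _)),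
      (defect_le_supp _).antisymm (hs.trans hd), (codefect_le_supp _).antisymm (hs.trans hc)⟩

theorem Balanced.mul {α β : BrauerGraph X} (hα : α.Balanced) (hβ : β.Balanced) :
    (α * β).Balanced := by
  by_cases hω : Cardinal.aleph0 ≤ α.supp ∨ Cardinal.aleph0 ≤ β.supp
  · refine balanced_mul_of_aleph0_le ?_
    rcases le_total α.supp β.supp with h | h
    · exact Or.inr ⟨hω.elim (fun h' => h'.trans h) id, h, hα, hβ⟩
    · exact Or.inl ⟨hω.elim id (fun h' => h'.trans h), h, hα, hβ⟩
  push Not at hω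
  have hs : (α * β).supp < Cardinal.aleph0 :=
    (supp_mul_le α β).trans_lt (Cardinal.add_lt_aleph0 hω.1 hω.2)
  refine Or.inl ⟨hs, fun hd => ?_⟩
  -- Both factors have defect at most one, hence no shift, and `β` has no upper hook.
  have hαd : α.defect ≤ 1 := (defect_le_defect_mul α β).trans hd
  have hβd : β.defect ≤ 1 := by
    rw [defect_eq_codefect hω.2]
    exact (codefect_le_codefect_mul α β).trans (defect_eq_codefect hs ▸ hd)
  have hα0 := (hα.resolve_right fun h => hω.1.not_ge h.1).2 hαd
  have hβ0 := (hβ.resolve_right fun h => hω.2.not_ge h.1).2 hβd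
  refine shift_eq_zero fun x y hxy => ?_
  obtain ⟨z, hz⟩ := dom_mul_subset α β ⟨y, hxy⟩
  obtain rfl := eq_of_shift_eq_zero hα0 hz
  by_cases hx : x ∈ β.dom
  · obtain ⟨z, hz'⟩ := hx
    obtain rfl := eq_of_shift_eq_zero hβ0 hz'
    exact eq_of_adj_right (mul_adj_transversal hz hz') hxy
  · have := mem_of_reachable (S := {.upper x, .middle x}) ?_ hxy.2 (Or.inl rfl)
    · rcases this with h | h <;> cases h
    · rintro a (rfl | rfl) b hb
      · obtain ⟨w, rfl, hw⟩ := prodGraph_adj_upper.1 hb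
        rw [α.eq_of_adj hw hz]
        exact Or.inr rfl
      · rcases prodGraph_adj_middle.1 hb with ⟨w, rfl, hw⟩ | ⟨w | w, rfl, hw⟩
        · rw [α.eq_of_adj hw hz.symm]
          exact Or.inl rfl
        · exact absurd hw (not_adj_upper_of_defect_le_one hβd)
        · exact absurd ⟨w, hw⟩ hx

end BrauerGraph

theorem theorem5 (X : Type u) [Infinite X] :
    (idempotentGenerated (BrauerGraph X) : Set (BrauerGraph X)) =
      {α | α.defect ≤ 1 ∧ α.shift = 0} ∪
      {α | 2 ≤ α.defect ∧ α.supp < Cardinal.aleph0} ∪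
      {α | α.defect = α.codefect ∧ max Cardinal.aleph0 α.shift ≤ α.defect} := by
  rw [Set.union_assoc]
  refine Set.Subset.antisymm (fun α hα => (BrauerGraph.balanced_iff α).1 ?_) ?_
  · exact Subsemigroup.closure_induction (p := fun α _ => α.Balanced)
      (fun _ h => BrauerGraph.balanced_of_isIdempotentElem h) (fun _ _ _ _ => .mul) hα
  · rintro α (⟨-, h⟩ | ⟨h₁, h₂⟩ | ⟨h₁, h₂⟩)
    · exact BrauerGraph.mem_of_shift_eq_zero h
    · exact BrauerGraph.mem_of_supp_lt_aleph0 h₁ h₂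
    · exact BrauerGraph.mem_of_defect_eq_codefect h₁ h₂
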